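/- Call a group $T$ \emph{freely telescopic} if for every finite group $\Gamma$ there exists a free subgroup $H \leq T$ of finite index such that $N_T(H)/H \cong \Gamma$, where $N_T(H) = \{g \in T : gHg^{-1} = H\}$ is the normaliser of $H$ in $T$. For $n \geq 2$ let $\mathbb{Z}_n$ denote the cyclic group of order $n$. Then for all integers $p \geq 3$ and $q \geq 2$ the free product $\mathbb{Z}_p * \mathbb{Z}_q$ is freely telescopic. -/

import Mathlib

universe u v

/-- A group `T` is freely telescopic if for every finite group `Γ` there is a free subgroup
`H ≤ T` of finite index such that `N_T(H) / H ≅ Γ`. The universe `v` is that of `Γ`. -/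
def IsFreelyTelescopic (T : Type u) [Group T] : Prop :=
  ∀ (Γ : Type v) [Group Γ] [Finite Γ],
    ∃ H : Subgroup T, H.FiniteIndex ∧ IsFreeGroup H ∧
      Nonempty
        ((Subgroup.normalizer (H : Set T) ⧸ H.subgroupOf (Subgroup.normalizer (H : Set T))) ≃* Γ)

/-- The free product `ℤ_p * ℤ_q` of two cyclic groups, written multiplicatively. -/
abbrev FreeProdCyclic (p q : ℕ) : Type :=
  Monoid.Coprod (Multiplicative (ZMod p)) (Multiplicative (ZMod q))

/-! `H` is the stabiliser of a point `x₀` in an action of `A ∗ B` on the finite set `B × A × Γ × Fin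
n`. The first two coordinates record the images in `B` and `A`, so `H` dies in `A × B` and is free
(`isFreeGroup_of_fst_eq_one_of_snd_eq_one`). Left multiplication by `Γ` commutes with the action, so
`N(H)/H ≅ Γ` as soon as the orbit of `x₀` contains `Γ x₀` and no point outside `Γ x₀` has stabiliser
`H` (`nonempty_normalizer_quotient_mulEquiv`). On the fibre over `(1, 1)` commutators of `b` with
powers of `a` act as `r` and `t⁻¹`. Which words fix a point depends only on its stabiliser, and the
fixed points of `t`, at places 0, 1, 3 of the rotation in `r`, locate `x₀` up to `Γ`
(`isMarked_iff`). -/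

open Equiv Monoid

/-! ### Actions of a free product twisted by a coboundary -/

section TwistedAction

variable {A B Z : Type*} [Group A] [Group B]

/-- The action of `A ∗ B` on `B × A × Z` in which `b : B` multiplies the first coordinate and
`a : A` multiplies the second coordinate and acts on the third one by the coboundary of `d`. -/
def twistedHom (d : B → A → Perm Z) : Coprod A B →* Perm (B × A × Z) :=
  Coprod.lift
    (MonoidHom.toHomPerm
      { toFun := fun a x ↦ (x.1, a * x.2.1, d x.1 (a * x.2.1) ((d x.1 x.2.1).symm x.2.2))
        map_one' := by funext x; simp; rfl
        map_mul' := fun a a' ↦ by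
          funext x
          change _ = (_, _, _)
          simp [mul_assoc] })
    (MonoidHom.toHomPerm
      { toFun := fun b x ↦ (b * x.1, x.2.1, x.2.2)
        map_one' := by funext x; simp; rfl
        map_mul' := fun b b' ↦ by
          funext x
          change _ = (_, _, _)
          simp [mul_assoc] })

@[simp]
theorem twistedHom_inl (d : B → A → Perm Z) (a i : A) (j : B) (z : Z) :
    twistedHom d (Coprod.inl a) (j, i, z) = (j, a * i, d j (a * i) ((d j i).symm z)) := by
  rw [twistedHom, Coprod.lift_apply_inl]
  rfl

@[simp]
theorem twistedHom_inr (d : B → A → Perm Z) (b j : B) (i : A) (z : Z) :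
    twistedHom d (Coprod.inr b) (j, i, z) = (b * j, i, z) := by
  rw [twistedHom, Coprod.lift_apply_inr]
  rfl

theorem twistedHom_comm (d : B → A → Perm Z) (σ : Perm Z)
    (hσ : ∀ j i z, d j i (σ z) = σ (d j i z)) (g : Coprod A B) :
    ∀ j i z, twistedHom d g (j, i, σ z) =
      ((twistedHom d g (j, i, z)).1, (twistedHom d g (j, i, z)).2.1,
        σ (twistedHom d g (j, i, z)).2.2) := by
  have hσ' : ∀ j i z, (d j i).symm (σ z) = σ ((d j i).symm z) := fun j i z ↦ by
    rw [Equiv.symm_apply_eq, hσ, Equiv.apply_symm_apply]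
  induction g using Coprod.induction_on with
  | inl a => intro j i z; simp [hσ, hσ']
  | inr b => intro j i z; simp
  | mul g h hg hh => intro j i z; rw [map_mul, Perm.mul_apply, hh, hg]; simp

theorem twistedHom_fst (d : B → A → Perm Z) (g : Coprod A B) :
    ∀ j i z, (twistedHom d g (j, i, z)).1 = Coprod.snd g * j ∧
      (twistedHom d g (j, i, z)).2.1 = Coprod.fst g * i := by
  induction g using Coprod.induction_on with
  | inl a => intro j i z; simp
  | inr b => intro j i z; simp
  | mul g h hg hh =>
    intro j i z
    obtain ⟨h1, h2⟩ := hh j i z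
    obtain ⟨h3, h4⟩ := hg _ _ (twistedHom d h (j, i, z)).2.2
    rw [map_mul, Perm.mul_apply]
    constructor
    · rw [map_mul, mul_assoc, ← h1]; exact h3
    · rw [map_mul, mul_assoc, ← h2]; exact h4

end TwistedAction

/-! ### Freeness of subgroups of the Cartesian kernel -/

section Free

variable {A B : Type*} [Group A] [Group B]

/-- The twist by left multiplications by the free generators indexed by `B × A`. -/
def freeTwist (j : B) (i : A) : Perm (FreeGroup (B × A)) := Equiv.mulLeft (FreeGroup.of (j, i))

/-- The homomorphism sending the generators to the commutators of the two factors. -/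
def commutatorHom : FreeGroup (B × A) →* Coprod A B :=
  FreeGroup.lift fun x ↦
    (Coprod.inl x.2)⁻¹ * (Coprod.inr x.1)⁻¹ * Coprod.inl x.2 * Coprod.inr x.1

/-- This equivariance towards left translation recovers `g` from its free-group coordinate, whence
injectivity on the kernel. -/
theorem commutatorHom_twistedHom (g : Coprod A B) : ∀ x : B × A × FreeGroup (B × A),
    Coprod.inr (twistedHom freeTwist g x).1 * Coprod.inl (twistedHom freeTwist g x).2.1 *
        commutatorHom (twistedHom freeTwist g x).2.2 =
      g * (Coprod.inr x.1 * Coprod.inl x.2.1 * commutatorHom x.2.2) := by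
  induction g using Coprod.induction_on with
  | inl a =>
    rintro ⟨j, i, z⟩
    simp [freeTwist, commutatorHom]
    group
  | inr b => rintro ⟨j, i, z⟩; simp [mul_assoc]
  | mul g h hg hh => intro x; rw [map_mul, Perm.mul_apply, hg, hh]; simp only [mul_assoc]

/-- A subgroup of a free product contained in the kernel of the map to the direct product is
free. -/
theorem isFreeGroup_of_fst_eq_one_of_snd_eq_one (H : Subgroup (Coprod A B))
    (hfst : ∀ g ∈ H, Coprod.fst g = 1) (hsnd : ∀ g ∈ H, Coprod.snd g = 1) : IsFreeGroup H := by
  have key : ∀ g ∈ H, ∀ z, twistedHom freeTwist g (1, 1, z) =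
      (1, 1, (twistedHom freeTwist g (1, 1, 1)).2.2 * z) := by
    intro g hg z
    have h := twistedHom_comm freeTwist (Equiv.mulRight z)
      (by intro j i w; simp [freeTwist, mul_assoc]) g 1 1 1
    have h' := twistedHom_fst freeTwist g 1 1 1
    rw [hfst g hg, hsnd g hg, mul_one, mul_one] at h'
    rw [h'.1, h'.2] at h
    simpa using h
  let φ : H →* FreeGroup (B × A) :=
    MonoidHom.mk' (fun g ↦ (twistedHom freeTwist (g : Coprod A B) (1, 1, 1)).2.2) (by
      intro g h
      have h1 := key h h.2 1
      have h2 := key g g.2 ((twistedHom freeTwist (h : Coprod A B) (1, 1, 1)).2.2)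
      rw [Subgroup.coe_mul, map_mul, Perm.mul_apply, h1, mul_one, h2])
  have hφ : Function.Injective φ := by
    rw [injective_iff_map_eq_one]
    intro g hg
    have h1 := key g g.2 1
    have hg' : (twistedHom freeTwist (g : Coprod A B) (1, 1, 1)).2.2 = 1 := hg
    have h2 := commutatorHom_twistedHom (g : Coprod A B) (1, 1, 1)
    rw [h1, hg'] at h2
    simpa using h2.symm
  exact IsFreeGroup.ofMulEquiv (MonoidHom.ofInjective hφ).symm

end Free

/-! ### Normaliser quotients of point stabilisers -/

theorem nonempty_normalizer_quotient_mulEquiv {T Γ X : Type*} [Group T] [Group Γ]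
    (φ : T →* Perm X) (θ : Γ →* Perm X) (x₀ : X) (H : Subgroup T)
    (hH : ∀ g, g ∈ H ↔ φ g x₀ = x₀)
    (hcomm : ∀ g γ x, φ g (θ γ x) = θ γ (φ g x))
    (hfree : ∀ γ, θ γ x₀ = x₀ → γ = 1)
    (htrans : ∀ γ, ∃ g, φ g x₀ = θ γ x₀)
    (hchar : ∀ x, (∀ g, φ g x = x ↔ φ g x₀ = x₀) → ∃ γ, x = θ γ x₀) :
    Nonempty ((Subgroup.normalizer (H : Set T) ⧸
      H.subgroupOf (Subgroup.normalizer (H : Set T))) ≃* Γ) := by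
  have hinj : ∀ γ γ', θ γ x₀ = θ γ' x₀ → γ = γ' := fun γ γ' h ↦ by
    have : θ (γ'⁻¹ * γ) x₀ = x₀ := by simp [h]
    exact (inv_mul_eq_one.mp (hfree _ this)).symm
  have hmem : ∀ g, g ∈ Subgroup.normalizer (H : Set T) ↔ ∃ γ, φ g x₀ = θ γ x₀ := by
    intro g
    have hconj : ∀ h, g⁻¹ * h * g ∈ H ↔ φ h (φ g x₀) = φ g x₀ := fun h ↦ by
      rw [hH, map_mul, map_mul, map_inv, Perm.mul_apply, Perm.mul_apply, Perm.inv_eq_iff_eq]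
    constructor
    · intro hg
      apply hchar
      intro h
      rw [← hconj, ← hH]
      have := Subgroup.mem_normalizer_iff''.mp hg h
      exact this.symm
    · rintro ⟨γ, hγ⟩
      rw [Subgroup.mem_normalizer_iff'']
      intro h
      refine Iff.trans (hH h) (Iff.trans ?_ (hconj h).symm)
      rw [hγ, hcomm, (θ γ).injective.eq_iff]
  choose! f hf using fun g ↦ (hmem g).mp
  -- Since `φ` and `θ` commute, `f` reverses products; hence the inverse.
  let ψ : Subgroup.normalizer (H : Set T) →* Γ := MonoidHom.mk' (fun g ↦ (f g)⁻¹) (by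
    intro g h
    rw [← mul_inv_rev, inv_inj]
    apply hinj
    rw [← hf _ (g * h).2, map_mul, Perm.mul_apply, Subgroup.coe_mul, map_mul, Perm.mul_apply,
      hf _ h.2, hcomm, hf _ g.2])
  have hψ : Function.Surjective ψ := by
    intro γ
    obtain ⟨g, hg⟩ := htrans γ⁻¹
    have hgN := (hmem g).mpr ⟨_, hg⟩
    refine ⟨⟨g, hgN⟩, ?_⟩
    have : f g = γ⁻¹ := hinj _ _ (by rw [← hf _ hgN, hg])
    simp [ψ, this]
  have hker : H.subgroupOf (Subgroup.normalizer (H : Set T)) = ψ.ker := by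
    ext g
    rw [Subgroup.mem_subgroupOf, hH, MonoidHom.mem_ker, hf _ g.2]
    change _ ↔ (f g)⁻¹ = 1
    rw [inv_eq_one]
    exact ⟨hfree _, fun h ↦ by rw [h]; simp⟩
  exact ⟨(QuotientGroup.quotientMulEquivOfEq hker).trans
    (QuotientGroup.quotientKerEquivOfSurjective ψ hψ)⟩

/-! ### The asymmetric pattern -/

/-- An asymmetric pair of permutations: a rotation `ρ`, and a permutation `τ` whose fixed points
are `y₀`, `ρ y₀` and `ρ³ y₀`; and a surjection trivial on the fixed points of `τ`. -/
theorem exists_rotation_and_asymmetric_perm (Γ : Type*) [Group Γ] [Finite Γ] :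
    ∃ (n : ℕ) (τ ρ : Perm (Fin n)) (y₀ : Fin n) (v : Fin n → Γ),
      (∀ y y', ∃ m : ℕ, (ρ ^ m) y = y') ∧ (∀ y, ρ y ≠ y) ∧ (∀ y, ρ (τ y) ≠ y) ∧
      τ y₀ = y₀ ∧ τ (ρ y₀) = ρ y₀ ∧ τ (ρ (ρ (ρ y₀))) = ρ (ρ (ρ y₀)) ∧
      (∀ y, τ y = y → τ (ρ y) = ρ y → τ (ρ (ρ (ρ y))) = ρ (ρ (ρ y)) → y = y₀) ∧
      (∀ y, τ (ρ (ρ (ρ y))) = ρ (ρ (ρ y)) → τ (ρ (ρ y)) = ρ (ρ y) → τ y ≠ y) ∧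
      (∀ y, τ y = y → v y = 1) ∧ Function.Surjective v := by
  obtain ⟨k, ⟨e⟩⟩ := Finite.exists_equiv_fin Γ
  -- Fixes 0, 1, 3 and cycles 2 → 4 → 5 → … → k + 5 → 2. Modulo 5 the set {0, 1, 3} would contain
  -- its own mirror pattern; at least six points prevent this.
  let f : Fin (k + 6) → Fin (k + 6) := fun y ↦
    ⟨if y.1 = 0 ∨ y.1 = 1 ∨ y.1 = 3 then y.1 else if y.1 = 2 then 4
      else if y.1 = k + 5 then 2 else y.1 + 1, by split_ifs <;> omega⟩
  have hf : Function.Injective f := by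
    intro x y h
    have h' := congrArg Fin.val h
    simp only [f] at h'
    ext
    split_ifs at h' <;> omega
  let τ : Perm (Fin (k + 6)) := Equiv.ofBijective f (Finite.injective_iff_bijective.mp hf)
  let ρ : Perm (Fin (k + 6)) := Equiv.addRight 1
  have hρ : ∀ y, (ρ y).1 = if y.1 = k + 5 then 0 else y.1 + 1 := fun y ↦ by
    change (y + 1).1 = _
    rw [Fin.val_add_one]
    simp [Fin.ext_iff]
  have hτ : ∀ y, (τ y).1 = if y.1 = 0 ∨ y.1 = 1 ∨ y.1 = 3 then y.1 else if y.1 = 2 then 4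
      else if y.1 = k + 5 then 2 else y.1 + 1 := fun y ↦ rfl
  have hfix : ∀ y, τ y = y ↔ y.1 = 0 ∨ y.1 = 1 ∨ y.1 = 3 := fun y ↦ by
    rw [Fin.ext_iff, hτ]
    split_ifs <;> omega
  refine ⟨k + 6, τ, ρ, 0,
    fun y ↦ if h : 4 ≤ y.1 ∧ y.1 - 4 < k then e.symm ⟨y.1 - 4, h.2⟩ else 1,
    fun y y' ↦ ⟨y'.1 + (k + 6) - y.1, ?_⟩, fun y ↦ ?_, fun y ↦ ?_, ?_, ?_, ?_, fun y ↦ ?_, fun y ↦ ?_,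
    fun y ↦ ?_, fun γ ↦ ?_⟩
  · have h : ∀ m : ℕ, ((ρ ^ m) y).1 = (y.1 + m) % (k + 6) := fun m ↦ by
      induction m with
      | zero => simp [Nat.mod_eq_of_lt y.2]
      | succ m ih =>
        rw [pow_succ', Perm.mul_apply]
        change ((ρ ^ m) y + 1).1 = _
        rw [Fin.val_add, ih]
        simp [add_assoc]
    rw [Fin.ext_iff, h, show y.1 + (y'.1 + (k + 6) - y.1) = y'.1 + (k + 6) by omega,
      Nat.add_mod_right, Nat.mod_eq_of_lt y'.2]
  · rw [Ne, Fin.ext_iff, hρ]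
    split_ifs <;> omega
  · rw [Ne, Fin.ext_iff, hρ, hτ]
    split_ifs <;> omega
  · simp [hfix]
  · simp [hfix, hρ]
  · simp [hfix, hρ]
  · have h1 := hρ y
    have h2 := hρ (ρ y)
    have h3 := hρ (ρ (ρ y))
    rw [hfix, hfix, hfix, Fin.ext_iff]
    change _ → _ → _ → y.1 = 0
    split_ifs at h1 h2 h3 <;> omega
  · have h1 := hρ y
    have h2 := hρ (ρ y)
    have h3 := hρ (ρ (ρ y))
    rw [Ne, hfix, hfix, hfix]
    split_ifs at h1 h2 h3 <;> omega
  · rw [hfix]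
    intro h
    exact dif_neg (by omega)
  · refine ⟨⟨(e γ).1 + 4, by omega⟩, ?_⟩
    simp

/-! ### Commutator words and marked points -/

section Words

variable {A B Z : Type*} [Group B]

open Classical in
/-- The twist equal to `c` in the layer `1` and trivial in all other layers. -/
noncomputable def layerTwist (c : A → Perm Z) (j : B) : A → Perm Z := if j = 1 then c else 1

theorem layerTwist_one (c : A → Perm Z) : layerTwist c (1 : B) = c := if_pos rfl

theorem layerTwist_of_ne (c : A → Perm Z) {j : B} (hj : j ≠ 1) (i : A) :
    layerTwist c j i = 1 := by
  rw [layerTwist, if_neg hj, Pi.one_apply]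

variable [Group A]

/-- The commutator `b⁻¹ m⁻¹ b m` in the free product. -/
def commutatorWord (b : B) (m : A) : Coprod A B :=
  Coprod.inr b⁻¹ * Coprod.inl m⁻¹ * Coprod.inr b * Coprod.inl m

theorem twistedHom_commutatorWord (d : B → A → Perm Z) (b j : B) (m i : A) (z : Z) :
    twistedHom d (commutatorWord b m) (j, i, z) =
      (j, i, d (b * j) i ((d (b * j) (m * i)).symm (d j (m * i) ((d j i).symm z)))) := by
  simp only [commutatorWord, map_mul, Perm.mul_apply, twistedHom_inl, twistedHom_inr,
    inv_mul_cancel_left]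

theorem layerTwist_commutatorWord_one (c : A → Perm Z) {b : B} (hb : b ≠ 1) (m i : A) (z : Z) :
    twistedHom (layerTwist c) (commutatorWord b m) (1, i, z) =
      (1, i, c (m * i) ((c i).symm z)) := by
  rw [twistedHom_commutatorWord, layerTwist_one, mul_one, layerTwist_of_ne c hb,
    layerTwist_of_ne c hb]
  rfl

theorem layerTwist_commutatorWord_inv (c : A → Perm Z) {b j : B} (hj : j ≠ 1) (hbj : b * j = 1)
    (m i : A) (z : Z) :
    twistedHom (layerTwist c) (commutatorWord b m) (j, i, z) =
      (j, i, c i ((c (m * i)).symm z)) := by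
  rw [twistedHom_commutatorWord, hbj, layerTwist_one, layerTwist_of_ne c hj,
    layerTwist_of_ne c hj]
  rfl

theorem layerTwist_commutatorWord_eq_self_iff (c : A → Perm Z) {b : B} (hb : b ≠ 1) (j : B)
    (m i : A) (z : Z) :
    twistedHom (layerTwist c) (commutatorWord b m) (j, i, z) = (j, i, z) ↔
      (j = 1 ∨ b * j = 1 → c (m * i) ((c i).symm z) = z) := by
  by_cases hj : j = 1
  · subst hj
    simp [layerTwist_commutatorWord_one c hb]
  by_cases hbj : b * j = 1
  · rw [layerTwist_commutatorWord_inv c hj hbj]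
    simp only [Prod.mk.injEq, true_and, hbj, or_true, true_imp_iff]
    rw [← Equiv.eq_symm_apply, Equiv.symm_apply_eq, eq_comm]
  · rw [twistedHom_commutatorWord]
    simp [layerTwist_of_ne c hj, layerTwist_of_ne c hbj, hj, hbj]

open Classical in
/-- The twist with values `t` at `1`, `r * t` at `a` and `1` elsewhere. -/
noncomputable def pairTwist (a : A) (t r : Perm Z) (i : A) : Perm Z :=
  if i = 1 then t else if i = a then r * t else 1

/-- The words `[b, a⁻¹]` and `[b, a²]` fix the point `x`, and the word `[b, a]` does not. -/
def IsMarked (φ : Coprod A B →* Perm Z) (a : A) (b : B) (x : Z) : Prop :=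
  φ (commutatorWord b a⁻¹) x = x ∧ φ (commutatorWord b (a * a)) x = x ∧
    φ (commutatorWord b a) x ≠ x

theorem IsMarked.of_forall_eq_iff {a : A} {b : B} (φ : Coprod A B →* Perm Z) {x x₀ : Z}
    (hx : ∀ g, φ g x = x ↔ φ g x₀ = x₀) (g : Coprod A B) (h : IsMarked φ a b (φ g x₀)) :
    IsMarked φ a b (φ g x) := by
  have hconj : ∀ y h, φ (g⁻¹ * h * g) y = y ↔ φ h (φ g y) = φ g y := fun y h ↦ by
    rw [map_mul, map_mul, map_inv, Perm.mul_apply, Perm.mul_apply, Perm.inv_eq_iff_eq]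
  simpa only [IsMarked, Ne, ← hconj, hx] using h

variable {a : A} {b : B} {t r : Perm Z}

theorem pairTwist_one : pairTwist a t r 1 = t := if_pos rfl

theorem pairTwist_self (ha : a ≠ 1) : pairTwist a t r a = r * t := by
  rw [pairTwist, if_neg ha, if_pos rfl]

theorem pairTwist_of_ne {i : A} (h1 : i ≠ 1) (ha : i ≠ a) : pairTwist a t r i = 1 := by
  rw [pairTwist, if_neg h1, if_neg ha]

/-- In the two layers that see the twist, column `a` fails since `r` has no fixed points, column
`a⁻¹` since `r * t` has none, and in any other column except 1 the word `[b, a]` acts trivially. -/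
theorem isMarked_iff (ha : a * a ≠ 1) (hb : b ≠ 1) (hr : ∀ z, r z ≠ z) (hrt : ∀ z, r (t z) ≠ z)
    (j : B) (i : A) (z : Z) :
    IsMarked (twistedHom (layerTwist (pairTwist a t r))) a b (j, i, z) ↔
      (j = 1 ∨ b * j = 1) ∧ i = 1 ∧ t z = z := by
  have ha1 : a ≠ 1 := fun h ↦ ha (by simp [h])
  rw [IsMarked, Ne, layerTwist_commutatorWord_eq_self_iff _ hb,
    layerTwist_commutatorWord_eq_self_iff _ hb, layerTwist_commutatorWord_eq_self_iff _ hb]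
  by_cases hj : j = 1 ∨ b * j = 1
  swap
  · simp [hj]
  simp only [hj, true_imp_iff, true_and]
  by_cases hi : i = 1
  · subst hi
    have h1 : a⁻¹ ≠ a := fun h ↦ ha (by nth_rewrite 1 [← h]; simp)
    rw [mul_one, mul_one, mul_one, pairTwist_one, pairTwist_self ha1,
      pairTwist_of_ne (inv_ne_one.mpr ha1) h1, pairTwist_of_ne ha (by simpa using ha1)]
    simp [Equiv.symm_apply_eq, hr, eq_comm (a := z)]
  simp only [hi, false_and, iff_false]
  rintro ⟨h1, h2, h3⟩
  by_cases hia : i = a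
  · subst hia
    rw [inv_mul_cancel, pairTwist_one, pairTwist_self ha1] at h1
    obtain ⟨u, rfl⟩ := (r * t).surjective z
    rw [Equiv.symm_apply_apply] at h1
    exact hr _ h1.symm
  rw [pairTwist_of_ne hi hia] at h2 h3
  by_cases hai : a * i = 1
  · rw [mul_assoc, hai, mul_one, pairTwist_self ha1] at h2
    exact hrt _ h2
  · rw [pairTwist_of_ne hai (by simpa using hi)] at h3
    exact h3 rfl

end Words

/-! ### Assembly -/

theorem isFreelyTelescopic_coprod {A B : Type u} [Group A] [Group B] [Finite A] [Finite B]
    {a : A} (ha : a * a ≠ 1) {b : B} (hb : b ≠ 1) :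
    IsFreelyTelescopic.{u, v} (Coprod A B) := by
  intro Γ _ _
  obtain ⟨n, τ, ρ, y₀, w, hρt, hρ, hρτ, h0, h1, h3, hpos, hneg, hw, hws⟩ :=
    exists_rotation_and_asymmetric_perm Γ
  have ha1 : a ≠ 1 := fun h ↦ ha (by simp [h])
  let t : Perm (Γ × Fin n) :=
    { toFun := fun z ↦ (z.1 * w z.2, τ z.2)
      invFun := fun z ↦ (z.1 * (w (τ.symm z.2))⁻¹, τ.symm z.2)
      left_inv := fun z ↦ by simp
      right_inv := fun z ↦ by simp }
  let r : Perm (Γ × Fin n) := (Equiv.refl Γ).prodCongr ρ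
  have hr : ∀ z, r z ≠ z := fun z h ↦ hρ z.2 (congrArg Prod.snd h)
  have hrt : ∀ z, r (t z) ≠ z := fun z h ↦ hρτ z.2 (congrArg Prod.snd h)
  have ht : ∀ z, t z = z ↔ τ z.2 = z.2 := fun z ↦
    ⟨fun h ↦ congrArg Prod.snd h, fun h ↦ Prod.ext (by simp [t, hw _ h]) h⟩
  let φ : Coprod A B →* Perm (B × A × Γ × Fin n) := twistedHom (layerTwist (pairTwist a t r))
  let θ : Γ →* Perm (B × A × Γ × Fin n) := MonoidHom.toHomPerm
    { toFun := fun γ x ↦ (x.1, x.2.1, γ * x.2.2.1, x.2.2.2)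
      map_one' := by funext x; simp; rfl
      map_mul' := fun γ γ' ↦ by
        funext x
        change _ = (_, _, _, _)
        simp [mul_assoc] }
  have hθ : ∀ γ x, θ γ x = (x.1, x.2.1, γ * x.2.2.1, x.2.2.2) := fun γ x ↦ rfl
  have hstep : ∀ z, φ (commutatorWord b a) (1, 1, z) = (1, 1, r z) := fun z ↦ by
    rw [layerTwist_commutatorWord_one _ hb, mul_one, pairTwist_self ha1, pairTwist_one]
    simp
  have hstep_inv : ∀ j, j ≠ 1 → b * j = 1 →
      ∀ z, φ (commutatorWord b a) (j, 1, z) = (j, 1, r.symm z) := fun j hj hbj z ↦ by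
    rw [layerTwist_commutatorWord_inv _ hj hbj, mul_one, pairTwist_self ha1, pairTwist_one,
      Perm.mul_def, Equiv.symm_trans_apply, Equiv.apply_symm_apply]
  have hstep' : ∀ z, φ (commutatorWord b a⁻¹) (1, 1, z) = (1, 1, t.symm z) := fun z ↦ by
    have h : a⁻¹ ≠ a := fun h ↦ ha (by nth_rewrite 1 [← h]; simp)
    rw [layerTwist_commutatorWord_one _ hb, mul_one, pairTwist_of_ne (inv_ne_one.mpr ha1) h,
      pairTwist_one]
    rfl
  let x₀ : B × A × Γ × Fin n := (1, 1, 1, y₀)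
  have hH : ∀ g, g ∈ (MulAction.stabilizer (Perm (B × A × Γ × Fin n)) x₀).comap φ ↔
    φ g x₀ = x₀ := fun g ↦ Iff.rfl
  have hfst : ∀ g, φ g x₀ = x₀ → x₀.1 = Coprod.snd g * 1 ∧ x₀.2.1 = Coprod.fst g * 1 :=
    fun g hg ↦ by
      have h : (φ g x₀).1 = Coprod.snd g * 1 ∧ (φ g x₀).2.1 = Coprod.fst g * 1 :=
        twistedHom_fst _ g 1 1 (1, y₀)
      rwa [hg] at h
  have hfin : ((MulAction.stabilizer (Perm (B × A × Γ × Fin n)) x₀).comap φ).FiniteIndex :=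
    ⟨by
      rw [Subgroup.index_comap]
      exact Subgroup.FiniteIndex.index_ne_zero⟩
  refine ⟨(MulAction.stabilizer (Perm (B × A × Γ × Fin n)) x₀).comap φ, hfin,
    isFreeGroup_of_fst_eq_one_of_snd_eq_one _ (fun g hg ↦ ?_) (fun g hg ↦ ?_),
    nonempty_normalizer_quotient_mulEquiv φ θ x₀ _ hH ?_ (fun γ h ↦ ?_) (fun γ ↦ ?_) ?_⟩
  · simpa [x₀] using (hfst g hg).2.symm
  · simpa [x₀] using (hfst g hg).1.symm
  · rintro g γ ⟨j, i, z⟩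
    refine twistedHom_comm _ ((Equiv.mulLeft γ).prodCongr (Equiv.refl _)) (fun j i z ↦ ?_) g j i z
    have hc : ∀ i z, pairTwist a t r i ((Equiv.mulLeft γ).prodCongr (Equiv.refl _) z) =
        (Equiv.mulLeft γ).prodCongr (Equiv.refl _) (pairTwist a t r i z) := fun i z ↦ by
      unfold pairTwist
      split_ifs <;> simp [t, r, mul_assoc]
    unfold layerTwist
    split_ifs
    · exact hc i z
    · rfl
  · have h' := congrArg (fun x ↦ x.2.2.1) h
    simpa [hθ, x₀] using h'
  · have hrot : ∀ (γ' : Γ) (y y' : Fin n), (∃ g, φ g x₀ = (1, 1, γ', y)) →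
        ∃ g, φ g x₀ = (1, 1, γ', y') := by
      rintro γ' y y' ⟨g, hg⟩
      obtain ⟨m, rfl⟩ := hρt y y'
      refine ⟨commutatorWord b a ^ m * g, ?_⟩
      rw [map_mul, Perm.mul_apply, hg]
      induction m with
      | zero => simp
      | succ m ih => rw [pow_succ', map_mul, Perm.mul_apply, ih, hstep, pow_succ']; rfl
    -- Rotate to `τ y`, apply `t⁻¹`, which multiplies by `(w y)⁻¹ = γ`, then rotate back to `y₀`.
    obtain ⟨y, hy⟩ := hws γ⁻¹
    obtain ⟨g, hg⟩ := hrot 1 y₀ (τ y) ⟨1, by simp [x₀]⟩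
    rw [hθ]
    simp only [x₀, mul_one]
    refine hrot γ y y₀ ⟨commutatorWord b a⁻¹ * g, ?_⟩
    rw [map_mul, Perm.mul_apply, hg, hstep']
    simp [t, hy]
  · intro x hx
    have hmark := fun g ↦ IsMarked.of_forall_eq_iff (a := a) (b := b) φ hx g
    have key := isMarked_iff (Z := Γ × Fin n) ha hb hr hrt
    obtain ⟨j, i, γ, y⟩ := x
    have m0 := hmark 1
    have m1 := hmark (commutatorWord b a)
    have m3 := hmark (commutatorWord b a * (commutatorWord b a * commutatorWord b a))
    simp only [map_one, Perm.one_apply, map_mul, Perm.mul_apply, x₀, hstep] at m0 m1 m3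
    replace m0 := m0 ((key _ _ _).mpr ⟨Or.inl rfl, rfl, (ht _).mpr h0⟩)
    replace m1 := m1 ((key _ _ _).mpr ⟨Or.inl rfl, rfl, (ht _).mpr h1⟩)
    replace m3 := m3 ((key _ _ _).mpr ⟨Or.inl rfl, rfl, (ht _).mpr h3⟩)
    obtain ⟨hj, rfl, t0⟩ := (key _ _ _).mp m0
    by_cases hj1 : j = 1
    · subst hj1
      rw [hstep] at m1
      rw [hstep, hstep, hstep] at m3
      have t1 := ((key _ _ _).mp m1).2.2
      have t3 := ((key _ _ _).mp m3).2.2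
      rw [ht] at t0 t1 t3
      obtain rfl := hpos y t0 t1 t3
      exact ⟨γ, by simp [hθ, x₀]⟩
    -- In layer `b⁻¹` the word `[b, a]` rotates backwards, so the marks would form the mirror image
    -- of the pattern 0, 1, 3, which `hneg` excludes.
    · have hbj := hj.resolve_left hj1
      rw [hstep_inv j hj1 hbj] at m1
      rw [hstep_inv j hj1 hbj, hstep_inv j hj1 hbj, hstep_inv j hj1 hbj] at m3
      have t1 := ((key _ _ _).mp m1).2.2
      have t3 := ((key _ _ _).mp m3).2.2
      rw [ht] at t0 t1 t3
      refine (hneg (ρ.symm (ρ.symm (ρ.symm y))) ?_ ?_ t3).elim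
      · simpa using t0
      · simpa using (show τ (ρ.symm y) = ρ.symm y from t1)

theorem mainTheorem7 (p q : ℕ) (hp : 3 ≤ p) (hq : 2 ≤ q) :
    IsFreelyTelescopic.{0, v} (FreeProdCyclic p q) := by
  have : NeZero p := ⟨by omega⟩
  have : NeZero q := ⟨by omega⟩
  have : Fact (1 < q) := ⟨by omega⟩
  refine isFreelyTelescopic_coprod (a := Multiplicative.ofAdd 1) (b := Multiplicative.ofAdd 1)
    ?_ ?_
  · rw [← ofAdd_add, Ne, ofAdd_eq_one, one_add_one_eq_two]
    intro h
    have h2 : ((2 : ℕ) : ZMod p) = 0 := by exact_mod_cast h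
    rw [ZMod.natCast_eq_zero_iff] at h2
    exact absurd (Nat.le_of_dvd two_pos h2) (by omega)
  · rw [Ne, ofAdd_eq_one]
    exact one_ne_zero
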